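/- Let $\nu_1,\nu_2\ge 1$ be fixed integers and let $\lambda>1$ be a fixed real number. For each integer $M\ge 1$, coupons are drawn one at a time, independently and with replacement, from a mixture of two groups: Group 1 consists of $\nu_1M$ coupons, each drawn with probability $p_1=p_1(M)>0$, and Group 2 consists of $\nu_2M$ coupons, each drawn with probability $p_2=p_2(M)>0$, where $p_2/p_1=\lambda$ (so that $\nu_1Mp_1+\nu_2Mp_2=1$). Let $T=T(M)$ be the number of draws needed until every coupon of both groups has been drawn at least once. Then $E[T(T+1)]<\infty$ for every $M\ge1$, and for every $\varepsilon>0$ $$E[T(T+1)] = (\nu_1+\lambda\nu_2)^2 M^2\left(H_{\nu_1M}^2+\sum_{j=1}^{\nu_1M}\frac1{j^2}\right)+O\left(M^{3-\lambda+\varepsilon}\right)\qquad\text{as } M\to\infty,$$ where $H_N=\sum_{j=1}^N 1/j$ is the $N$-th harmonic number and the implied constant may depend on $\nu_1,\nu_2,\lambda,\varepsilon$. -/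

import Mathlib

open MeasureTheory ProbabilityTheory Filter Asymptotics
open scoped ENNReal

/-- Independent sampling with replacement from two groups of coupons: `M₁` coupons (the left
summand), each of probability `p₁ > 0`, and `M₂` coupons (the right summand), each of probability
`p₂ > 0`. The random variable `C k` is the coupon drawn at the `(k + 1)`-th trial. -/
structure IsCouponSampling {Ω : Type*} [MeasurableSpace Ω] (P : Measure Ω) {M₁ M₂ : ℕ}
    (p₁ p₂ : ℝ) (C : ℕ → Ω → Fin M₁ ⊕ Fin M₂) : Prop where
  isProbabilityMeasure : IsProbabilityMeasure P
  measurable : ∀ k, Measurable (C k)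
  indep : iIndepFun C P
  pos₁ : 0 < p₁
  pos₂ : 0 < p₂
  prob₁ : ∀ k (i : Fin M₁), P.real {ω | C k ω = Sum.inl i} = p₁
  prob₂ : ∀ k (i : Fin M₂), P.real {ω | C k ω = Sum.inr i} = p₂

/-- The number of trials needed to detect every coupon of the set `A`: the least `n` such that
each coupon of `A` occurs among the first `n` trials, and `⊤` if there is no such `n`. -/
noncomputable def detectionTime {Ω κ : Type*} (C : ℕ → Ω → κ) (A : Set κ) (ω : Ω) : ℕ∞ :=
  ⨅ n ∈ {n : ℕ | ∀ c ∈ A, ∃ k < n, C k ω = c}, (n : ℕ∞)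

/-- The number of trials needed to detect all the coupons of the first group. -/
noncomputable def detectionTime₁ {Ω : Type*} {M₁ M₂ : ℕ} (C : ℕ → Ω → Fin M₁ ⊕ Fin M₂) (ω : Ω) :
    ℕ∞ :=
  detectionTime C (Set.range Sum.inl) ω

/-- The number of trials needed to detect all the coupons of the second group. -/
noncomputable def detectionTime₂ {Ω : Type*} {M₁ M₂ : ℕ} (C : ℕ → Ω → Fin M₁ ⊕ Fin M₂) (ω : Ω) :
    ℕ∞ :=
  detectionTime C (Set.range Sum.inr) ω

/-- The number of trials needed to detect all the coupons of both groups. -/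
noncomputable def totalDetectionTime {Ω : Type*} {M₁ M₂ : ℕ} (C : ℕ → Ω → Fin M₁ ⊕ Fin M₂)
    (ω : Ω) : ℕ∞ :=
  max (detectionTime₁ C ω) (detectionTime₂ C ω)

/-- The second rising moment `E[T (T + 1)]`, an expectation in `[0, ∞]`. -/
noncomputable def secondRisingMoment {Ω : Type*} [MeasurableSpace Ω] (P : Measure Ω)
    (T : Ω → ℕ∞) : ℝ≥0∞ :=
  ∫⁻ ω, (T ω : ℝ≥0∞) * ((T ω : ℝ≥0∞) + 1) ∂P

/-! Summation by parts gives `E[T (T + 1)] = ∑ 2 (n + 1) P(T > n)`. The event `T > n` contains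
"group 1 is incomplete after `n` draws" and is covered by it together with, for each coupon `c` of
group 2, "group 1 is complete but `c` is missing".

Both kinds of event reduce to one sum, `hasSum_collected_inter_avoided`: the weighted probabilities
that `N` coupons of probability `p` are all seen while a set of total probability `x p` is unseen
add up to `2 / p ^ 2 * betaDeriv N x`. At `x = 1` these values are the increments of the main term
(`hasSum_compl_collected`). At `x = λ` they are `O(N ^ (-λ + ε))`; with `ν₂ M` coupons and `1 / p₁ ^
2` of order `M ^ 2`, this gives the error term. -/

/-! ### Events of collecting and avoiding coupons. -/

section Events

variable {Ω κ : Type*}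

/-- The event that every coupon of `G` occurs among the first `n` draws. -/
def collectedEvent (C : ℕ → Ω → κ) (n : ℕ) (G : Finset κ) : Set Ω :=
  {ω | ∀ c ∈ G, ∃ k < n, C k ω = c}

/-- The event that no coupon of `B` occurs among the first `n` draws. -/
def avoidedEvent (C : ℕ → Ω → κ) (n : ℕ) (B : Finset κ) : Set Ω :=
  {ω | ∀ k < n, C k ω ∉ B}

lemma collectedEvent_empty (C : ℕ → Ω → κ) (n : ℕ) : collectedEvent C n ∅ = Set.univ := by
  simp [collectedEvent]

lemma collectedEvent_anti (C : ℕ → Ω → κ) (n : ℕ) {G G' : Finset κ} (h : G ⊆ G') :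
    collectedEvent C n G' ⊆ collectedEvent C n G :=
  fun _ hω c hc => hω c (h hc)

lemma collectedEvent_mono (C : ℕ → Ω → κ) {m n : ℕ} (h : m ≤ n) (G : Finset κ) :
    collectedEvent C m G ⊆ collectedEvent C n G := fun _ hω c hc =>
  let ⟨k, hk, hkc⟩ := hω c hc
  ⟨k, hk.trans_le h, hkc⟩

lemma collectedEvent_insert [DecidableEq κ] (C : ℕ → Ω → κ) (n : ℕ) (a : κ) (G : Finset κ) :
    collectedEvent C n (insert a G) = collectedEvent C n G \ avoidedEvent C n {a} := by
  ext ω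
  simp [collectedEvent, avoidedEvent, and_comm]

lemma avoidedEvent_insert [DecidableEq κ] (C : ℕ → Ω → κ) (n : ℕ) (a : κ) (B : Finset κ) :
    avoidedEvent C n (insert a B) = avoidedEvent C n {a} ∩ avoidedEvent C n B := by
  ext ω
  simp only [avoidedEvent, Finset.mem_insert, not_or, Finset.mem_singleton, Set.mem_inter_iff,
    Set.mem_ofPred_eq]
  grind

variable [MeasurableSpace Ω] [MeasurableSpace κ] [MeasurableSingletonClass κ]

lemma measurableSet_avoidedEvent {C : ℕ → Ω → κ} (hC : ∀ k, Measurable (C k)) (n : ℕ)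
    (B : Finset κ) : MeasurableSet (avoidedEvent C n B) := by
  have : avoidedEvent C n B = ⋂ k, ⋂ (_ : k < n), (C k ⁻¹' (B : Set κ))ᶜ := by
    ext ω; simp [avoidedEvent]
  rw [this]
  exact MeasurableSet.iInter fun k => MeasurableSet.iInter fun _ =>
    (hC k B.measurableSet).compl

lemma measurableSet_collectedEvent {C : ℕ → Ω → κ} (hC : ∀ k, Measurable (C k)) (n : ℕ)
    (G : Finset κ) : MeasurableSet (collectedEvent C n G) := by
  classical
  induction G using Finset.induction_on with
  | empty => simp [collectedEvent_empty]
  | insert a G _ ih =>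
    rw [collectedEvent_insert]
    exact ih.diff (measurableSet_avoidedEvent hC n _)

variable {P : Measure Ω} [IsProbabilityMeasure P] {C : ℕ → Ω → κ} {q : κ → ℝ}

lemma measureReal_preimage_finset (hC : ∀ k, Measurable (C k))
    (hq : ∀ k c, P.real {ω | C k ω = c} = q c) (k : ℕ) (B : Finset κ) :
    P.real (C k ⁻¹' (B : Set κ)) = ∑ c ∈ B, q c := by
  have : C k ⁻¹' (B : Set κ) = ⋃ c ∈ B, {ω | C k ω = c} := by
    ext ω; simp
  rw [this, measureReal_biUnion_finset]
  · exact Finset.sum_congr rfl fun c _ => hq k c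
  · intro c _ d _ hcd
    exact Set.disjoint_left.2 fun ω h1 h2 => hcd (h1.symm.trans h2)
  · exact fun c _ => hC k (measurableSet_singleton c)

lemma measureReal_avoidedEvent (hC : ∀ k, Measurable (C k)) (hind : iIndepFun C P)
    (hq : ∀ k c, P.real {ω | C k ω = c} = q c) (n : ℕ) (B : Finset κ) :
    P.real (avoidedEvent C n B) = (1 - ∑ c ∈ B, q c) ^ n := by
  have : avoidedEvent C n B = ⋂ k ∈ Finset.range n, C k ⁻¹' (B : Set κ)ᶜ := by
    ext ω; simp [avoidedEvent]
  rw [this, measureReal_def, hind.measure_inter_preimage_eq_mul (Finset.range n)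
    (fun k _ => B.measurableSet.compl), ENNReal.toReal_prod]
  rw [Finset.prod_congr rfl (g := fun _ => 1 - ∑ c ∈ B, q c), Finset.prod_const, Finset.card_range]
  intro k _
  rw [← measureReal_def, Set.preimage_compl, probReal_compl_eq_one_sub (hC k B.measurableSet),
    measureReal_preimage_finset hC hq]

end Events

/-! ### The Beta function at integer first differences, and its derivative. -/

section PartialFractions

/-- The Beta-integral `∫₀¹ t ^ (x - 1) (1 - t) ^ N dt` in closed form. -/
noncomputable def betaProduct (N : ℕ) (x : ℝ) : ℝ :=
  (N.factorial : ℝ) / ∏ k ∈ Finset.range (N + 1), (x + k)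

/-- The shifted harmonic number `∑_{k ≤ N} 1 / (x + k)`. -/
noncomputable def shiftedHarmonic (N : ℕ) (x : ℝ) : ℝ :=
  ∑ k ∈ Finset.range (N + 1), 1 / (x + k)

lemma prod_shift_eq (N : ℕ) {x : ℝ} (hx : 0 < x) :
    ∏ k ∈ Finset.range (N + 1), (x + 1 + k) =
      (∏ k ∈ Finset.range (N + 1), (x + k)) * (x + N + 1) / x := by
  have h := Finset.prod_range_succ' (fun k : ℕ => x + (k : ℝ)) (N + 1)
  rw [Finset.prod_range_succ] at h
  rw [eq_div_iff hx.ne']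
  push_cast at h
  rw [add_assoc, h]
  simp only [add_zero]
  congr 1
  exact Finset.prod_congr rfl fun k _ => by ring

lemma betaProduct_shift (N : ℕ) {x : ℝ} (hx : 0 < x) :
    betaProduct N (x + 1) = betaProduct N x * x / (x + N + 1) := by
  have h1 : ∏ k ∈ Finset.range (N + 1), (x + k) ≠ 0 :=
    (Finset.prod_pos fun k _ => by positivity).ne'
  rw [betaProduct, betaProduct, prod_shift_eq N hx]
  field_simp

lemma betaProduct_succ (N : ℕ) {x : ℝ} (hx : 0 < x) :
    betaProduct (N + 1) x = betaProduct N x * (N + 1) / (x + N + 1) := by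
  have h1 : ∏ k ∈ Finset.range (N + 1), (x + k) ≠ 0 :=
    (Finset.prod_pos fun k _ => by positivity).ne'
  rw [betaProduct, betaProduct, Finset.prod_range_succ _ (N + 1), Nat.factorial_succ]
  push_cast
  rw [← add_assoc]
  field_simp

lemma shiftedHarmonic_succ (N : ℕ) (x : ℝ) :
    shiftedHarmonic (N + 1) x = shiftedHarmonic N x + 1 / (x + N + 1) := by
  rw [shiftedHarmonic, Finset.sum_range_succ, shiftedHarmonic]
  push_cast
  rw [add_assoc x]

lemma shiftedHarmonic_shift (N : ℕ) (x : ℝ) :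
    shiftedHarmonic N (x + 1) = shiftedHarmonic N x - 1 / x + 1 / (x + N + 1) := by
  have h := Finset.sum_range_succ' (fun k : ℕ => 1 / (x + (k : ℝ))) (N + 1)
  rw [Finset.sum_range_succ] at h
  push_cast at h
  have h2 : shiftedHarmonic N (x + 1) = ∑ k ∈ Finset.range (N + 1), 1 / (x + ((k : ℝ) + 1)) :=
    Finset.sum_congr rfl fun k _ => by ring
  rw [h2, shiftedHarmonic, add_assoc x]
  simp only [add_zero] at h
  linarith

/-- `∑_{k ≤ N} (-1) ^ k (N choose k) / (x + k) ^ 2` in closed form. -/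
noncomputable def betaDeriv (N : ℕ) (x : ℝ) : ℝ := betaProduct N x * shiftedHarmonic N x

lemma betaDeriv_zero {x : ℝ} : betaDeriv 0 x = 1 / x ^ 2 := by
  simp [betaDeriv, betaProduct, shiftedHarmonic, sq]

/-- `betaDeriv N` is minus the derivative in `x` of the Beta integral, where an extra factor `1 - t`
produces this difference. The same recursion governs moving a coupon from unseen to seen, so the
alternating inclusion-exclusion sum is never expanded. -/
lemma betaDeriv_succ (N : ℕ) {x : ℝ} (hx : 0 < x) :
    betaDeriv (N + 1) x = betaDeriv N x - betaDeriv N (x + 1) := by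
  simp only [betaDeriv]
  rw [betaProduct_succ N hx, betaProduct_shift N hx, shiftedHarmonic_succ, shiftedHarmonic_shift]
  have : x + N + 1 ≠ 0 := by positivity
  field_simp
  ring

lemma betaDeriv_one (N : ℕ) : betaDeriv N 1 = (harmonic (N + 1) : ℝ) / (N + 1) := by
  have h1 : betaProduct N 1 = 1 / (N + 1) := by
    induction N with
    | zero => simp [betaProduct]
    | succ N ih => rw [betaProduct_succ N one_pos, ih]; push_cast; field_simp; abel
  have h2 : shiftedHarmonic N 1 = (harmonic (N + 1) : ℝ) := by
    simp [shiftedHarmonic, harmonic, add_comm]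
  rw [betaDeriv, h1, h2]
  ring

end PartialFractions

/-! ### Exact weighted sums of the event probabilities. -/

section Moments

variable {Ω κ : Type*} [MeasurableSpace Ω] [MeasurableSpace κ] [MeasurableSingletonClass κ]
  {P : Measure Ω} [IsProbabilityMeasure P] {C : ℕ → Ω → κ} {q : κ → ℝ}

lemma hasSum_two_mul_succ_mul_pow {r : ℝ} (hr : 0 < r) (hr1 : r ≤ 1) :
    HasSum (fun n : ℕ => 2 * ((n : ℝ) + 1) * (1 - r) ^ n) (2 / r ^ 2) := by
  have h := (hasSum_choose_mul_geometric_of_norm_lt_one 1 (𝕜 := ℝ) (r := 1 - r)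
    (by rw [Real.norm_eq_abs, abs_lt]; constructor <;> linarith)).mul_left 2
  convert! h using 1
  · ext n; simp [mul_assoc]
  · rw [sub_sub_cancel]; ring

/-- The weighted sum of the probabilities that the coupons of `G`, each of probability `p`, have all
been drawn, while those of `B` have not. -/
lemma hasSum_collected_inter_avoided (hC : ∀ k, Measurable (C k)) (hind : iIndepFun C P)
    (hq : ∀ k c, P.real {ω | C k ω = c} = q c) {p : ℝ} (hp : 0 < p) (G B : Finset κ)
    (hG : ∀ c ∈ G, q c = p) (hGB : Disjoint G B) (hB : 0 < ∑ c ∈ B, q c) :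
    HasSum (fun n : ℕ => 2 * ((n : ℝ) + 1) *
        P.real (collectedEvent C n G ∩ avoidedEvent C n B))
      (2 / p ^ 2 * betaDeriv G.card ((∑ c ∈ B, q c) / p)) := by
  classical
  -- `B` must vary: the step also uses `insert a B`, which raises the ratio `(∑ c ∈ B, q c) / p` by
  -- exactly 1.
  induction G using Finset.induction_on generalizing B with
  | empty =>
    have h1 : ∑ c ∈ B, q c ≤ 1 := by
      rw [← measureReal_preimage_finset hC hq 0 B]
      exact measureReal_le_one
    simp only [collectedEvent_empty, Set.univ_inter, measureReal_avoidedEvent hC hind hq,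
      Finset.card_empty, betaDeriv_zero]
    convert hasSum_two_mul_succ_mul_pow hB h1 using 1
    field_simp
  | insert a G haG ih =>
    rw [Finset.disjoint_insert_left] at hGB
    have hG' : ∀ c ∈ G, q c = p := fun c hc => hG c (Finset.mem_insert_of_mem hc)
    have hsum : ∑ c ∈ insert a B, q c = p + ∑ c ∈ B, q c := by
      rw [Finset.sum_insert hGB.1, hG a (Finset.mem_insert_self a G)]
    have h1 := ih B hG' hGB.2 hB
    have h2 := ih (insert a B) hG'
      (Finset.disjoint_insert_right.2 ⟨haG, hGB.2⟩) (by rw [hsum]; positivity)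
    convert! h1.sub h2 using 1
    · ext n
      rw [← mul_sub]
      congr 1
      have hset : collectedEvent C n (insert a G) ∩ avoidedEvent C n B =
          (collectedEvent C n G ∩ avoidedEvent C n B) \
            (collectedEvent C n G ∩ avoidedEvent C n (insert a B)) := by
        rw [collectedEvent_insert, avoidedEvent_insert]
        ext ω
        simp only [Set.mem_inter_iff, Set.mem_sdiff]
        tauto
      rw [hset, measureReal_sdiff _
        ((measurableSet_collectedEvent hC n _).inter (measurableSet_avoidedEvent hC n _))]
      rw [avoidedEvent_insert]
      exact Set.inter_subset_inter_right _ Set.inter_subset_right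
    · rw [hsum, Finset.card_insert_of_notMem haG, betaDeriv_succ _ (div_pos hB hp), ← mul_sub,
        add_div, div_self hp.ne', add_comm 1]

/-- Adjoining `a` to `G` adds the disjoint event "`G` complete, `a` missing", whose ratio is `x =
1`. With `N = G.card`, its contribution `2 H_{N+1} / (p ^ 2 (N + 1))` is the increment of `(H_N ^ 2
+ ∑ 1 / j ^ 2) / p ^ 2`. -/
lemma hasSum_compl_collected (hC : ∀ k, Measurable (C k)) (hind : iIndepFun C P)
    (hq : ∀ k c, P.real {ω | C k ω = c} = q c) {p : ℝ} (hp : 0 < p) (G : Finset κ)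
    (hG : ∀ c ∈ G, q c = p) :
    HasSum (fun n : ℕ => 2 * ((n : ℝ) + 1) * P.real (collectedEvent C n G)ᶜ)
      (1 / p ^ 2 * ((harmonic G.card : ℝ) ^ 2 + ∑ j ∈ Finset.Icc 1 G.card, 1 / (j : ℝ) ^ 2)) := by
  classical
  induction G using Finset.induction_on with
  | empty => simp [collectedEvent_empty]
  | insert a G haG ih =>
    have hG' : ∀ c ∈ G, q c = p := fun c hc => hG c (Finset.mem_insert_of_mem hc)
    have ha : ∑ c ∈ {a}, q c = p := by simp [hG]
    have h := (ih hG').add (hasSum_collected_inter_avoided hC hind hq hp G {a} hG'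
      (Finset.disjoint_singleton_right.2 haG) (by rw [ha]; exact hp))
    convert! h using 1
    · ext n
      rw [← mul_add, ← measureReal_union]
      · congr 2
        rw [collectedEvent_insert]
        ext ω
        simp only [Set.mem_compl_iff, Set.mem_sdiff, Set.mem_union, Set.mem_inter_iff]
        tauto
      · exact Set.disjoint_left.2 fun ω h1 h2 => h1 h2.1
      · exact (measurableSet_collectedEvent hC n _).inter (measurableSet_avoidedEvent hC n _)
    · rw [ha, div_self hp.ne', betaDeriv_one, Finset.card_insert_of_notMem haG,
        Finset.sum_Icc_succ_top (by omega), harmonic_succ]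
      push_cast
      field_simp
      ring

end Moments

/-- The union bound keeps the condition that `G` is complete: without it each coupon of group 2
would cost `2 / p₂ ^ 2`, a total of order `M ^ 3`. -/
lemma measureReal_compl_collected_union_le {Ω κ : Type*} [MeasurableSpace Ω] [DecidableEq κ]
    {P : Measure Ω} [IsProbabilityMeasure P] {C : ℕ → Ω → κ} (n : ℕ)
    (G G' : Finset κ) :
    P.real (collectedEvent C n (G ∪ G'))ᶜ ≤ P.real (collectedEvent C n G)ᶜ +
      ∑ c ∈ G', P.real (collectedEvent C n G ∩ avoidedEvent C n {c}) := by
  induction G' using Finset.induction_on with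
  | empty => simp
  | insert a G' ha ih =>
    rw [Finset.sum_insert ha, Finset.union_insert]
    have : (collectedEvent C n (insert a (G ∪ G')))ᶜ ⊆ (collectedEvent C n (G ∪ G'))ᶜ ∪
        (collectedEvent C n G ∩ avoidedEvent C n {a}) := by
      intro ω h
      rw [collectedEvent_insert] at h
      have := @collectedEvent_anti _ _ C n G (G ∪ G') Finset.subset_union_left ω
      simp only [Set.mem_compl_iff, Set.mem_sdiff, Set.mem_union, Set.mem_inter_iff] at h ⊢
      tauto
    have h2 := (measureReal_mono (μ := P) this).trans (measureReal_union_le _ _)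
    linarith

/-! ### From detection times to tail sums. -/

section DetectionTime

lemma detectionTime_le_iff {Ω κ : Type*} (C : ℕ → Ω → κ) (G : Finset κ) (n : ℕ) (ω : Ω) :
    detectionTime C (G : Set κ) ω ≤ n ↔ ω ∈ collectedEvent C n G := by
  constructor
  · intro h
    by_contra hω
    have h1 : ((n : ℕ∞) + 1) ≤ detectionTime C (G : Set κ) ω := by
      refine le_iInf₂ fun m hm => ?_
      rw [ENat.add_one_le_iff (ENat.natCast_ne_top n), Nat.cast_lt]
      by_contra hmn
      exact hω (collectedEvent_mono C (not_lt.1 hmn) G hm)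
    rw [ENat.add_one_le_iff (ENat.natCast_ne_top n)] at h1
    exact absurd h (not_le.2 h1)
  · exact fun h => iInf₂_le n h

lemma totalDetectionTime_le_iff {Ω : Type*} {M₁ M₂ : ℕ} (C : ℕ → Ω → Fin M₁ ⊕ Fin M₂) (n : ℕ)
    (ω : Ω) :
    totalDetectionTime C ω ≤ n ↔
      ω ∈ collectedEvent C n (Finset.univ.image Sum.inl ∪ Finset.univ.image Sum.inr) := by
  have h1 : Set.range (Sum.inl : Fin M₁ → Fin M₁ ⊕ Fin M₂) =
      ((Finset.univ.image Sum.inl : Finset (Fin M₁ ⊕ Fin M₂)) : Set (Fin M₁ ⊕ Fin M₂)) := by simp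
  have h2 : Set.range (Sum.inr : Fin M₂ → Fin M₁ ⊕ Fin M₂) =
      ((Finset.univ.image Sum.inr : Finset (Fin M₁ ⊕ Fin M₂)) : Set (Fin M₁ ⊕ Fin M₂)) := by simp
  rw [totalDetectionTime, max_le_iff, detectionTime₁, detectionTime₂, h1, h2,
    detectionTime_le_iff, detectionTime_le_iff]
  simp only [collectedEvent, Finset.mem_union, Set.mem_ofPred_eq, or_imp, forall_and]

lemma ENat.toENNReal_mul_add_one_eq_tsum (t : ℕ∞) :
    (t : ℝ≥0∞) * ((t : ℝ≥0∞) + 1) =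
      ∑' n : ℕ, if (n : ℕ∞) < t then 2 * ((n : ℝ≥0∞) + 1) else 0 := by
  induction t using ENat.recTopCoe with
  | top =>
    simp only [ENat.toENNReal_top, ENat.natCast_lt_top, if_true]
    rw [ENNReal.top_mul (by simp), eq_comm, eq_top_iff,
      ← ENNReal.tsum_const_eq_top_of_ne_zero (α := ℕ) (c := 1) one_ne_zero]
    refine ENNReal.tsum_le_tsum fun n => ?_
    calc (1 : ℝ≥0∞) ≤ 2 * 1 := by norm_num
      _ ≤ 2 * ((n : ℝ≥0∞) + 1) := by gcongr; exact le_add_self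
  | coe N =>
    rw [tsum_eq_sum (s := Finset.range N) (fun n hn => by
      rw [if_neg]; simpa using hn)]
    rw [Finset.sum_congr rfl (g := fun n : ℕ => 2 * ((n : ℝ≥0∞) + 1)) (fun n hn => by
      rw [if_pos]; simpa using hn)]
    rw [ENat.toENNReal_coe]
    induction N with
    | zero => simp
    | succ N ih => rw [Finset.sum_range_succ, ← ih]; push_cast; ring

/-- Tonelli applied to `t (t + 1) = ∑_{n < t} 2 (n + 1)`. Working in `[0, ∞]` also covers `T = ⊤`,
so finiteness follows from summability alone. -/
lemma secondRisingMoment_eq_ofReal {Ω : Type*} [MeasurableSpace Ω] {P : Measure Ω}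
    [IsProbabilityMeasure P] {T : Ω → ℕ∞} {A : ℕ → Set Ω} (hA : ∀ n, MeasurableSet (A n))
    (hT : ∀ (n : ℕ) ω, (n : ℕ∞) < T ω ↔ ω ∈ A n) {s : ℝ}
    (hs : HasSum (fun n : ℕ => 2 * ((n : ℝ) + 1) * P.real (A n)) s) :
    secondRisingMoment P T = ENNReal.ofReal s := by
  rw [secondRisingMoment, ← hs.tsum_eq,
    ENNReal.ofReal_tsum_of_nonneg (fun n => by positivity) hs.summable]
  have h : ∀ ω, (T ω : ℝ≥0∞) * ((T ω : ℝ≥0∞) + 1) =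
      ∑' n : ℕ, (A n).indicator (fun _ => 2 * ((n : ℝ≥0∞) + 1)) ω := by
    intro ω
    classical
    rw [ENat.toENNReal_mul_add_one_eq_tsum]
    simp only [hT, Set.indicator_apply]
  simp_rw [h]
  rw [lintegral_tsum fun n => (measurable_const.indicator (hA n)).aemeasurable]
  refine tsum_congr fun n => ?_
  rw [lintegral_indicator_const (hA n), ENNReal.ofReal_mul (by positivity), measureReal_def,
    ENNReal.ofReal_toReal (measure_ne_top P _), ENNReal.ofReal_mul zero_le_two,
    ENNReal.ofReal_add (by positivity) zero_le_one]
  simp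

instance measurableSingletonClass_sum {α β : Type*} [MeasurableSpace α] [MeasurableSpace β]
    [MeasurableSingletonClass α] [MeasurableSingletonClass β] :
    MeasurableSingletonClass (α ⊕ β) where
  measurableSet_singleton := by
    rintro (a | b)
    · rw [← Set.image_singleton]
      exact (measurableSet_singleton a).inl_image
    · rw [← Set.image_singleton]
      exact (measurableSet_singleton b).inr_image

end DetectionTime

/-! ### Two-sided bounds for the two-group moment. -/

section TwoGroups

variable {Ω : Type*} [MeasurableSpace Ω] {P : Measure Ω} {M₁ M₂ : ℕ} {p₁ p₂ : ℝ}
  {C : ℕ → Ω → Fin M₁ ⊕ Fin M₂}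

lemma IsCouponSampling.measureReal_eq (h : IsCouponSampling P p₁ p₂ C) (k : ℕ)
    (c : Fin M₁ ⊕ Fin M₂) :
    P.real {ω | C k ω = c} = Sum.elim (fun _ => p₁) (fun _ => p₂) c := by
  rcases c with i | i
  · exact h.prob₁ k i
  · exact h.prob₂ k i

lemma IsCouponSampling.sum_prob (h : IsCouponSampling P p₁ p₂ C) : M₁ * p₁ + M₂ * p₂ = 1 := by
  have := h.isProbabilityMeasure
  have h1 := measureReal_preimage_finset h.measurable h.measureReal_eq 0 Finset.univ
  simpa using h1.symm

/-- The second rising moment of the total detection time is that of the detection time of the first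
group, up to the expected contribution of the event that the second group is completed later. -/
lemma IsCouponSampling.secondRisingMoment_bounds (h : IsCouponSampling P p₁ p₂ C) :
    secondRisingMoment P (totalDetectionTime C) ≠ ⊤ ∧
    |(secondRisingMoment P (totalDetectionTime C)).toReal -
      1 / p₁ ^ 2 * ((harmonic M₁ : ℝ) ^ 2 + ∑ j ∈ Finset.Icc 1 M₁, 1 / (j : ℝ) ^ 2)| ≤
      M₂ * (2 / p₁ ^ 2 * betaDeriv M₁ (p₂ / p₁)) := by
  have := h.isProbabilityMeasure
  set G₁ : Finset (Fin M₁ ⊕ Fin M₂) := Finset.univ.image Sum.inl with hG₁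
  set G₂ : Finset (Fin M₁ ⊕ Fin M₂) := Finset.univ.image Sum.inr with hG₂
  have hcard₁ : G₁.card = M₁ := by
    rw [hG₁, Finset.card_image_of_injective _ Sum.inl_injective, Finset.card_fin]
  have hcard₂ : G₂.card = M₂ := by
    rw [hG₂, Finset.card_image_of_injective _ Sum.inr_injective, Finset.card_fin]
  have hq₁ : ∀ c ∈ G₁, Sum.elim (fun _ => p₁) (fun _ => p₂) c = p₁ := by
    intro c hc
    obtain ⟨i, -, rfl⟩ := Finset.mem_image.1 hc
    rfl
  have hV := hasSum_compl_collected h.measurable h.indep h.measureReal_eq h.pos₁ G₁ hq₁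
  have hW : HasSum (fun n : ℕ => ∑ c ∈ G₂, 2 * ((n : ℝ) + 1) *
      P.real (collectedEvent C n G₁ ∩ avoidedEvent C n {c}))
      (M₂ * (2 / p₁ ^ 2 * betaDeriv M₁ (p₂ / p₁))) := by
    have hconst : (M₂ : ℝ) * (2 / p₁ ^ 2 * betaDeriv M₁ (p₂ / p₁)) =
        ∑ _c ∈ G₂, 2 / p₁ ^ 2 * betaDeriv M₁ (p₂ / p₁) := by
      rw [Finset.sum_const, hcard₂, nsmul_eq_mul]
    rw [hconst]
    refine hasSum_sum fun c hc => ?_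
    obtain ⟨i, -, rfl⟩ := Finset.mem_image.1 hc
    simpa [hcard₁] using hasSum_collected_inter_avoided h.measurable h.indep h.measureReal_eq
      h.pos₁ G₁ {Sum.inr i} hq₁ (by simp [hG₁]) (by simpa using h.pos₂)
  rw [hcard₁] at hV
  have hle (n : ℕ) : 2 * ((n : ℝ) + 1) * P.real (collectedEvent C n (G₁ ∪ G₂))ᶜ ≤
      2 * ((n : ℝ) + 1) * P.real (collectedEvent C n G₁)ᶜ + ∑ c ∈ G₂, 2 * ((n : ℝ) + 1) *
        P.real (collectedEvent C n G₁ ∩ avoidedEvent C n {c}) := by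
    rw [← Finset.mul_sum, ← mul_add]
    gcongr
    exact measureReal_compl_collected_union_le n G₁ G₂
  have hge (n : ℕ) : 2 * ((n : ℝ) + 1) * P.real (collectedEvent C n G₁)ᶜ ≤
      2 * ((n : ℝ) + 1) * P.real (collectedEvent C n (G₁ ∪ G₂))ᶜ := by
    gcongr
    · exact measure_ne_top _ _
    · exact collectedEvent_anti C n Finset.subset_union_left
  have hsum : Summable fun n : ℕ =>
      2 * ((n : ℝ) + 1) * P.real (collectedEvent C n (G₁ ∪ G₂))ᶜ :=
    (hV.add hW).summable.of_nonneg_of_le (fun n => by positivity) hle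
  have hs := hsum.hasSum
  have hlow := hasSum_le hge hV hs
  have hupp := hasSum_le hle hs (hV.add hW)
  rw [secondRisingMoment_eq_ofReal
    (fun n => (measurableSet_collectedEvent h.measurable n (G₁ ∪ G₂)).compl)
    (fun n ω => by rw [← not_le, totalDetectionTime_le_iff, Set.mem_compl_iff]) hs]
  refine ⟨ENNReal.ofReal_ne_top, ?_⟩
  rw [ENNReal.toReal_ofReal (tsum_nonneg fun n => by positivity), abs_of_nonneg (by linarith)]
  linarith

end TwoGroups

/-! ### Growth of `betaDeriv` and the final estimate. -/

section Asymptotics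

/-- Euler's limit: `betaProduct N x` is `N ^ (-x)` times the convergent sequence `Real.GammaSeq x
N`. -/
lemma betaProduct_isBigO {x : ℝ} :
    (fun N : ℕ => betaProduct N x) =O[atTop] fun N : ℕ => (N : ℝ) ^ (-x) := by
  have h1 : (fun N : ℕ => Real.GammaSeq x N) =O[atTop] fun _ => (1 : ℝ) :=
    (Real.GammaSeq_tendsto_Gamma x).isBigO_one ℝ
  have h2 := (isBigO_refl (fun N : ℕ => (N : ℝ) ^ (-x)) atTop).mul h1
  simp only [mul_one] at h2
  refine h2.congr' ?_ EventuallyEq.rfl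
  filter_upwards [eventually_gt_atTop 0] with N hN
  have hN' : (0 : ℝ) < N := Nat.cast_pos.2 hN
  rw [Real.GammaSeq, betaProduct, ← mul_div_assoc, ← mul_assoc, ← Real.rpow_add hN']
  simp

/-- Growth is only logarithmic, by comparison with the harmonic sum; absorbing the logarithm is the
source of `ε` in the theorem. -/
lemma shiftedHarmonic_isBigO {x : ℝ} (hx : 1 ≤ x) {ε : ℝ} (hε : 0 < ε) :
    (fun N : ℕ => shiftedHarmonic N x) =O[atTop] fun N : ℕ => (N : ℝ) ^ ε := by
  have hcast : Tendsto (fun N : ℕ => (N : ℝ)) atTop atTop := tendsto_natCast_atTop_atTop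
  have hlog : (fun N : ℕ => Real.log N) =O[atTop] fun N : ℕ => (N : ℝ) ^ ε :=
    ((isLittleO_log_rpow_atTop hε).comp_tendsto hcast).isBigO
  have hone : (fun _ : ℕ => (2 : ℝ)) =O[atTop] fun N : ℕ => (N : ℝ) ^ ε :=
    ((isLittleO_const_left_of_ne two_ne_zero).2 (by
      simpa [Function.comp_def] using tendsto_norm_atTop_atTop.comp
        ((tendsto_rpow_atTop hε).comp hcast))).isBigO
  refine IsBigO.trans (IsBigO.of_bound 1 (Eventually.of_forall fun N => ?_)) (hone.add hlog)
  have hle : shiftedHarmonic N x ≤ (harmonic (N + 1) : ℝ) := by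
    rw [shiftedHarmonic, harmonic]
    push_cast
    refine Finset.sum_le_sum fun k _ => ?_
    rw [← one_div]
    exact one_div_le_one_div_of_le (by positivity) (by linarith)
  have hpos : 0 ≤ shiftedHarmonic N x := Finset.sum_nonneg fun k _ => by positivity
  have hlast : (harmonic (N + 1) : ℝ) ≤ 2 + Real.log N := by
    have h := harmonic_le_one_add_log N
    rw [harmonic_succ]
    push_cast
    have : ((N : ℝ) + 1)⁻¹ ≤ 1 := inv_le_one_of_one_le₀ (by linarith [N.cast_nonneg (α := ℝ)])
    linarith
  rw [one_mul, Real.norm_of_nonneg hpos]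
  exact (hle.trans hlast).trans (le_abs_self _)

lemma betaDeriv_isBigO {x : ℝ} (hx : 1 ≤ x) {ε : ℝ} (hε : 0 < ε) :
    (fun N : ℕ => betaDeriv N x) =O[atTop] fun N : ℕ => (N : ℝ) ^ (-x + ε) := by
  refine (betaProduct_isBigO.mul (shiftedHarmonic_isBigO hx hε)).congr' EventuallyEq.rfl ?_
  filter_upwards [eventually_gt_atTop 0] with N hN
  rw [← Real.rpow_add (Nat.cast_pos.2 hN)]

end Asymptotics

theorem theorem7 (ν₁ ν₂ : ℕ) (hν₁ : 1 ≤ ν₁) (hν₂ : 1 ≤ ν₂) (lam : ℝ) (hlam : 1 < lam)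
    (Ω : ℕ → Type*) [∀ M, MeasurableSpace (Ω M)] (P : ∀ M, Measure (Ω M)) (p₁ p₂ : ℕ → ℝ)
    (C : ∀ M, ℕ → Ω M → Fin (ν₁ * M) ⊕ Fin (ν₂ * M))
    (hC : ∀ M, 1 ≤ M → IsCouponSampling (P M) (p₁ M) (p₂ M) (C M))
    (hratio : ∀ M, 1 ≤ M → p₂ M / p₁ M = lam) :
    (∀ M, 1 ≤ M → secondRisingMoment (P M) (totalDetectionTime (C M)) ≠ ⊤) ∧
    ∀ ε : ℝ, 0 < ε →
      (fun M : ℕ => (secondRisingMoment (P M) (totalDetectionTime (C M))).toReal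
          - ((ν₁ : ℝ) + lam * (ν₂ : ℝ)) ^ 2 * (M : ℝ) ^ 2 *
            (((harmonic (ν₁ * M) : ℚ) : ℝ) ^ 2 + ∑ j ∈ Finset.Icc 1 (ν₁ * M), 1 / (j : ℝ) ^ 2))
        =O[atTop] fun M : ℕ => (M : ℝ) ^ (3 - lam + ε) := by
  refine ⟨fun M hM => (hC M hM).secondRisingMoment_bounds.1, fun ε hε => ?_⟩
  -- An exact identity: total probability 1 gives `1 / p₁ = (ν₁ + λ ν₂) M`.
  have hp (M : ℕ) (hM : 1 ≤ M) : 1 / p₁ M ^ 2 = ((ν₁ : ℝ) + lam * ν₂) ^ 2 * (M : ℝ) ^ 2 := by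
    have hpos := (hC M hM).pos₁
    have h1 := (hC M hM).sum_prob
    rw [← hratio M hM]
    push_cast at h1
    have h2 : ((ν₁ : ℝ) + p₂ M / p₁ M * ν₂) * M = 1 / p₁ M := by
      rw [eq_div_iff hpos.ne', ← h1]
      field_simp
    rw [← mul_pow, h2, one_div_pow]
  have hν : Tendsto (fun M : ℕ => ν₁ * M) atTop atTop := tendsto_id.const_mul_atTop' hν₁
  have hD := (betaDeriv_isBigO hlam.le hε).comp_tendsto hν
  -- The cube is `M ^ 2` from `1 / p₁ ^ 2` times `M` from the number of coupons in group 2.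
  have hcube := (isBigO_refl (fun M : ℕ => (M : ℝ) ^ 3) atTop).mul hD
  have hright : (fun M : ℕ => (M : ℝ) ^ 3 *
      ((fun N : ℕ => (N : ℝ) ^ (-lam + ε)) ∘ fun M : ℕ => ν₁ * M) M) =O[atTop]
      fun M : ℕ => (M : ℝ) ^ (3 - lam + ε) := by
    -- The constant comes from splitting `(ν₁ M) ^ (-λ + ε)`.
    refine IsBigO.of_bound ((ν₁ : ℝ) ^ (-lam + ε)) ?_
    filter_upwards [eventually_gt_atTop 0] with M hM
    have hM' : (0 : ℝ) < M := Nat.cast_pos.2 hM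
    simp only [Function.comp_apply, Nat.cast_mul]
    rw [Real.norm_of_nonneg (by positivity), Real.norm_of_nonneg (by positivity)]
    rw [Real.mul_rpow (by positivity) (by positivity), mul_left_comm, ← Real.rpow_natCast,
      ← Real.rpow_add hM', Nat.cast_ofNat, ← add_assoc, ← sub_eq_add_neg]
  refine IsBigO.trans (IsBigO.of_bound (ν₂ * 2 * ((ν₁ : ℝ) + lam * ν₂) ^ 2) ?_)
    (hcube.trans hright)
  filter_upwards [eventually_ge_atTop 1] with M hM
  have h := (hC M hM).secondRisingMoment_bounds.2
  rw [hratio M hM, hp M hM] at h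
  refine h.trans ?_
  rw [show (2 : ℝ) / p₁ M ^ 2 = 2 * (1 / p₁ M ^ 2) by ring, hp M hM, norm_mul]
  calc _ = (ν₂ * 2 * ((ν₁ : ℝ) + lam * ν₂) ^ 2) * ((M : ℝ) ^ 3 * betaDeriv (ν₁ * M) lam) := by
        push_cast; ring
    _ ≤ _ := by
        rw [Real.norm_of_nonneg (by positivity : (0 : ℝ) ≤ (M : ℝ) ^ 3)]
        gcongr
        exact le_abs_self _
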